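/- Let $T>0$, $I=(0,T)$, $d\in\mathbb{N}$ and $\beta>0$, let $Y$ be a real Hilbert space, let $K\colon L^2(I;\mathbb{R}^d)\to Y$ be linear and continuous, and let $F\colon Y\to\mathbb{R}$ be strictly convex and continuously Fréchet differentiable. Let $\mathcal{M}(I;\mathbb{R}^d)$ be the space of $\mathbb{R}^d$-valued vector measures on $I$, paired with $\mathcal{C}_0(I;\mathbb{R}^d)$ (the continuous functions vanishing at the boundary of $I$, with the supremum norm of the Euclidean norm) by $\langle\varphi,q\rangle=\int_I(\varphi,\mathrm{d}q)_{\mathbb{R}^d}$, and normed by the dual norm $\|\cdot\|_{\mathcal{M}}$. Let $\operatorname{BV}(I;\mathbb{R}^d)$ be the set of all $u\in L^1(I;\mathbb{R}^d)$ that have a distributional derivative $u'\in\mathcal{M}(I;\mathbb{R}^d)$, i.e. $\int_I (u,\varphi')_{\mathbb{R}^d}\,\mathrm{d}t=-\langle\varphi,u'\rangle$ for all $\varphi\in\mathcal{C}_c^\infty(I;\mathbb{R}^d)$, with the norm $\|u\|_{\operatorname{BV}}=\|u'\|_{\mathcal{M}}+\|u\|_{L^1}$; recall that $\operatorname{BV}(I;\mathbb{R}^d)\subset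 L^2(I;\mathbb{R}^d)$. Put $$j(u)=F(Ku)+\beta\|u'\|_{\mathcal{M}},\qquad u\in\operatorname{BV}(I;\mathbb{R}^d),$$ and assume that $j$ is radially unbounded: $j(u_k)\to+\infty$ for every sequence $(u_k)$ in $\operatorname{BV}(I;\mathbb{R}^d)$ with $\|u_k\|_{\operatorname{BV}}\to\infty$. Then $j$ attains its minimum, i.e. there is $\bar u\in\operatorname{BV}(I;\mathbb{R}^d)$ with $j(\bar u)\le j(u)$ for all $u\in\operatorname{BV}(I;\mathbb{R}^d)$. -/

import Mathlib

open MeasureTheory Set Filter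
open scoped Topology ContDiff ZeroAtInfty Convolution

namespace BVMin

/-- Euclidean space `ℝ^d`. -/
abbrev Vec (d : ℕ) : Type := EuclideanSpace ℝ (Fin d)

/-- Lebesgue measure on the open interval `(0, T)`. -/
noncomputable abbrev vol (T : ℝ) : Measure ℝ := volume.restrict (Ioo 0 T)

/-- The space of `ℝ^d`-valued Borel vector measures on the open interval `(0, T)`. -/
abbrev VMeas (T : ℝ) (d : ℕ) : Type := VectorMeasure (Ioo (0 : ℝ) T) (Vec d)

/-- The duality pairing of a function `φ : (0, T) → ℝ^d` with a vector measure `q`, that is, the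
integral of the Euclidean inner product of `φ` with `dq`. -/
noncomputable def pairing {T : ℝ} {d : ℕ} (φ : Ioo (0 : ℝ) T → Vec d) (q : VMeas T d) : ℝ :=
  ∫ᵛ t, φ t ∂[innerSL ℝ; q]

/-- A vector measure with values in `ℝ^d` has finite variation. -/
instance isFiniteMeasure_variation {X : Type*} [MeasurableSpace X] {d : ℕ}
    (q : VectorMeasure X (Vec d)) : IsFiniteMeasure q.variation := by
  let s : Fin d → SignedMeasure X := fun i =>
    q.mapRange (EuclideanSpace.proj i : Vec d →L[ℝ] ℝ).toLinearMap.toAddMonoidHom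
      (EuclideanSpace.proj i : Vec d →L[ℝ] ℝ).continuous
  let m : Measure X := ∑ i, (s i).totalVariation
  have hfin : ∀ i, IsFiniteMeasure (s i).totalVariation := fun i => by
    unfold SignedMeasure.totalVariation
    infer_instance
  have hle : q.variation ≤ m := by
    refine VectorMeasure.variation_le_of_forall_enorm_le fun E _ => ?_
    have h1 : ‖q E‖ ≤ ∑ i, ‖(q E) i‖ := by
      conv_lhs => rw [← (EuclideanSpace.basisFun (Fin d) ℝ).sum_repr (q E)]
      refine (norm_sum_le _ _).trans (Finset.sum_le_sum fun i _ => ?_)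
      rw [norm_smul]
      simp
    calc ‖q E‖ₑ = ENNReal.ofReal ‖q E‖ := (ofReal_norm _).symm
      _ ≤ ENNReal.ofReal (∑ i, ‖(q E) i‖) := ENNReal.ofReal_le_ofReal h1
      _ = ∑ i, ENNReal.ofReal ‖(q E) i‖ := ENNReal.ofReal_sum_of_nonneg fun i _ => norm_nonneg _
      _ ≤ ∑ i, (s i).totalVariation E := by
        refine Finset.sum_le_sum fun i _ => ?_
        rw [ofReal_norm]
        exact (s i).enorm_le_totalVariation E
      _ = m E := by simp [m]
  exact isFiniteMeasure_of_le m hle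

lemma abs_pairing_le {T : ℝ} {d : ℕ} (φ : Ioo (0 : ℝ) T → Vec d) (q : VMeas T d) {C : ℝ}
    (h : ∀ t, ‖φ t‖ ≤ C) :
    |pairing φ q| ≤ ‖(innerSL ℝ : Vec d →L[ℝ] Vec d →L[ℝ] ℝ)‖ * q.variation.real univ * C := by
  have := VectorMeasure.norm_integral_le_of_norm_le_const (μ := q)
    (B := (innerSL ℝ : Vec d →L[ℝ] Vec d →L[ℝ] ℝ)) (f := φ) (C := C) (Eventually.of_forall h)
  rw [Real.norm_eq_abs] at this
  refine this.trans (le_of_eq (by ring))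

lemma integrable_of_C0 {T : ℝ} {d : ℕ} (φ : C₀(Ioo (0 : ℝ) T, Vec d)) (q : VMeas T d) :
    q.Integrable φ := by
  refine Integrable.of_bound (C := ‖φ‖) (map_continuous φ).aestronglyMeasurable
    (Eventually.of_forall fun t => ?_)
  exact φ.toBCF.norm_coe_le_norm t

/-- A vector measure, viewed as a continuous linear functional on `C₀((0, T); ℝ^d)`, the space of
continuous functions that vanish at the boundary, with the supremum norm. -/
noncomputable def toDual {T : ℝ} {d : ℕ} (q : VMeas T d) :
    StrongDual ℝ C₀(Ioo (0 : ℝ) T, Vec d) :=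
  LinearMap.mkContinuous
    { toFun := fun φ => pairing φ q
      map_add' := fun φ ψ =>
        VectorMeasure.integral_add (integrable_of_C0 φ q) (integrable_of_C0 ψ q)
      map_smul' := fun c φ => VectorMeasure.integral_smul φ q _ c }
    (‖(innerSL ℝ : Vec d →L[ℝ] Vec d →L[ℝ] ℝ)‖ * q.variation.real univ)
    fun φ => abs_pairing_le φ q fun t => φ.toBCF.norm_coe_le_norm t

/-- The norm of a vector measure: the dual norm, i.e. the supremum of the pairings with
`φ ∈ C₀((0, T); ℝ^d)` of supremum norm at most one. -/
noncomputable def mnorm {T : ℝ} {d : ℕ} (q : VMeas T d) : ℝ := ‖toDual q‖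

/-- Test functions: the smooth functions with compact support contained in `(0, T)`. -/
structure IsTest {d : ℕ} (T : ℝ) (φ : ℝ → Vec d) : Prop where
  smooth : ContDiff ℝ ∞ φ
  compact : HasCompactSupport φ
  supp : tsupport φ ⊆ Ioo 0 T

/-- The vector measure `q` is the distributional derivative of `u ∈ L¹((0, T); ℝ^d)`. -/
def HasDistribDeriv {T : ℝ} {d : ℕ} (u : Lp (Vec d) 1 (vol T)) (q : VMeas T d) : Prop :=
  ∀ φ : ℝ → Vec d, IsTest T φ →
    ∫ t in Ioo 0 T, inner ℝ (u t) (deriv φ t) = -pairing (fun t => φ t) q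

/-- The space `BV((0, T); ℝ^d)`: the integrable functions whose distributional derivative is a
vector measure. -/
def BV (T : ℝ) (d : ℕ) : Set (Lp (Vec d) 1 (vol T)) := {u | ∃ q : VMeas T d, HasDistribDeriv u q}

/-- The distributional derivative `u'` of `u ∈ BV((0, T); ℝ^d)`: the vector measure with the
property required in the definition of `BV` (there is only one). -/
noncomputable def distribDeriv {T : ℝ} {d : ℕ} (u : BV T d) : VMeas T d := u.2.choose

/-- The `BV` norm. -/
noncomputable def bvNorm {T : ℝ} {d : ℕ} (u : BV T d) : ℝ :=
  mnorm (distribDeriv u) + ‖(u : Lp (Vec d) 1 (vol T))‖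


/-- The pairings of a coordinate of `u` with the derivatives of scalar test functions are bounded
by the supremum of the test function. -/
lemma HasDistribDeriv.coord_bound {T : ℝ} {d : ℕ} {u : Lp (Vec d) 1 (vol T)} {q : VMeas T d}
    (h : HasDistribDeriv u q) (i : Fin d) {G : ℝ → ℝ} (hG : ContDiff ℝ ∞ G)
    (hc : HasCompactSupport G) (hs : tsupport G ⊆ Ioo 0 T) {C : ℝ} (hC : ∀ t, |G t| ≤ C) :
    |∫ t in Ioo 0 T, (u t) i * deriv G t| ≤
      ‖(innerSL ℝ : Vec d →L[ℝ] Vec d →L[ℝ] ℝ)‖ * q.variation.real univ * C := by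
  let e : Vec d := EuclideanSpace.single i 1
  have hsub : tsupport (fun t => G t • e) ⊆ tsupport G :=
    closure_mono (fun t ht => by
      simp only [Function.mem_support] at ht ⊢
      exact fun h0 => ht (by simp [h0]))
  have ht : IsTest T (fun t => G t • e) :=
    { smooth := hG.smul contDiff_const
      compact := hc.smul_right
      supp := hsub.trans hs }
  have hd : ∀ t, deriv (fun t => G t • e) t = deriv G t • e := fun t =>
    deriv_smul_const ((hG.differentiable (by simp)) t) e
  have key := h _ ht
  have : (∫ t in Ioo 0 T, inner ℝ (u t) (deriv (fun t => G t • e) t)) =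
      ∫ t in Ioo 0 T, (u t) i * deriv G t := by
    congr 1
    ext t
    rw [hd, inner_smul_right]
    simp [e, mul_comm, EuclideanSpace.inner_single_right]
  rw [← this, key, abs_neg]
  refine abs_pairing_le _ q fun t => ?_
  rw [norm_smul]
  simpa [e] using hC t

/-- Primitives of smooth functions with mean value zero and support in `(a, b)`. -/
lemma exists_primitive {g : ℝ → ℝ} (hg : ContDiff ℝ ∞ g) {a b T : ℝ} (ha : 0 < a) (hab : a ≤ b)
    (hb : b < T) (hsupp : ∀ t, t ∉ Ioo a b → g t = 0) (hint : ∫ t, g t = 0) :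
    ∃ G : ℝ → ℝ, ContDiff ℝ ∞ G ∧ HasCompactSupport G ∧ tsupport G ⊆ Ioo 0 T ∧
      (∀ t, |G t| ≤ ∫ s, |g s|) ∧ ∀ t, deriv G t = g t := by
  have hgi : Integrable g := by
    refine hg.continuous.integrable_of_hasCompactSupport ?_
    exact HasCompactSupport.intro (isCompact_Icc (a := a) (b := b)) fun t ht =>
      hsupp t fun h => ht (Ioo_subset_Icc_self h)
  let G : ℝ → ℝ := fun t => ∫ s in a..t, g s
  have hder : ∀ t, HasDerivAt G (g t) t := fun t =>
    intervalIntegral.integral_hasDerivAt_right (hg.continuous.intervalIntegrable _ _)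
      (hg.continuous.stronglyMeasurableAtFilter _ _) hg.continuous.continuousAt
  have hdG : deriv G = g := funext fun t => (hder t).deriv
  have hGa : ∀ t, t ≤ a → G t = 0 := fun t ht => by
    refine intervalIntegral.integral_zero_ae (Eventually.of_forall fun s hs => hsupp s ?_)
    rw [uIoc_of_ge ht] at hs
    exact fun h => absurd h.1 (not_lt.2 hs.2)
  have hGb : ∀ t, b ≤ t → G t = 0 := fun t ht => by
    have : G t = ∫ s in Ioc a t, g s := intervalIntegral.integral_of_le (hab.trans ht)
    rw [this, setIntegral_eq_integral_of_forall_compl_eq_zero, hint]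
    exact fun s hs => hsupp s fun h => hs ⟨h.1, h.2.le.trans ht⟩
  have hG0 : ∀ t, t ∉ Icc a b → G t = 0 := fun t ht => by
    rcases lt_or_ge t a with h | h
    · exact hGa t h.le
    · exact hGb t (not_lt.1 fun h' => ht ⟨h, h'.le⟩)
  refine ⟨G, contDiff_infty_iff_deriv.2 ⟨fun t => (hder t).differentiableAt, hdG ▸ hg⟩,
    HasCompactSupport.intro (isCompact_Icc (a := a) (b := b)) hG0, ?_, fun t => ?_,
    fun t => (hder t).deriv⟩
  · refine (closure_minimal (fun t ht => ?_) (isClosed_Icc (a := a) (b := b))).trans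
      (fun t ht => ⟨ha.trans_le ht.1, ht.2.trans_lt hb⟩)
    by_contra h
    exact ht (hG0 t h)
  · rcases le_or_gt t a with h | h
    · rw [hGa t h, abs_zero]
      exact integral_nonneg fun s => abs_nonneg _
    · refine (intervalIntegral.abs_integral_le_integral_abs h.le).trans ?_
      rw [intervalIntegral.integral_of_le h.le]
      exact setIntegral_le_integral hgi.abs (Eventually.of_forall fun s => abs_nonneg _)

/-- The coordinates of a function of bounded variation are essentially bounded. -/
lemma HasDistribDeriv.coord_ae_bounded {T : ℝ} {d : ℕ} {u : Lp (Vec d) 1 (vol T)} {q : VMeas T d}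
    (h : HasDistribDeriv u q) (hT : 0 < T) (i : Fin d) :
    ∃ M : ℝ, ∀ᵐ t ∂(vol T), |(u t) i| ≤ M := by
  let A : ℝ := ‖(innerSL ℝ : Vec d →L[ℝ] Vec d →L[ℝ] ℝ)‖ * q.variation.real univ
  have hA : 0 ≤ A := by positivity
  have hui : Integrable (fun t => (u t) i) (vol T) :=
    (EuclideanSpace.proj i : Vec d →L[ℝ] ℝ).integrable_comp (L1.integrable_coeFn u)
  let f : ℝ → ℝ := (Ioo 0 T).indicator fun t => (u t) i
  have hf : Integrable f := (integrable_indicator_iff measurableSet_Ioo).2 hui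
  -- a normalized bump in the middle of the interval
  let η : ContDiffBump (T / 2) := ⟨T / 8, T / 4, by positivity, by linarith⟩
  let φ : ℕ → ContDiffBump (0 : ℝ) := fun n =>
    ⟨1 / (n + 1), 2 / (n + 1), by positivity, by gcongr; norm_num⟩
  have hφ : Tendsto (fun n => (φ n).rOut) atTop (𝓝 0) := by
    have := (tendsto_one_div_add_atTop_nhds_zero_nat (𝕜 := ℝ)).const_mul 2
    simpa only [φ, mul_one_div, mul_zero] using this
  have hconv := ContDiffBump.ae_convolution_tendsto_right_of_locallyIntegrable (μ := volume)
    (K := 2) hφ (Eventually.of_forall fun n => le_of_eq (by simp only [φ]; ring))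
    hf.locallyIntegrable
  refine ⟨A * 2 + |∫ t, f t * η.normed volume t|, ?_⟩
  rw [ae_restrict_iff' measurableSet_Ioo]
  filter_upwards [hconv] with x hx hxI
  have hfx : f x = (u x) i := indicator_of_mem hxI _
  rw [← hfx]
  refine le_of_tendsto hx.abs ?_
  have hx0 : 0 < min x (T - x) := lt_min hxI.1 (sub_pos.2 hxI.2)
  filter_upwards [hφ.eventually (gt_mem_nhds (half_pos hx0))] with n hn
  have hr := (φ n).rOut_pos
  let ρ : ℝ → ℝ := fun t => (φ n).normed volume (x - t)
  have hρs : ContDiff ℝ ∞ ρ :=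
    ((φ n).contDiff_normed (μ := volume)).comp (contDiff_const.sub contDiff_id)
  have hρ1 : ∫ t, ρ t = 1 := by
    rw [integral_sub_left_eq_self (fun t => (φ n).normed volume t) volume x]
    exact (φ n).integral_normed
  have hρi : Integrable ρ := ((φ n).integrable_normed (μ := volume)).comp_sub_left x
  have hηi : Integrable (η.normed volume) := η.integrable_normed
  have hxl := min_le_left x (T - x)
  have hxr := min_le_right x (T - x)
  let a := min (x / 2) (T / 4)
  let b := max ((x + T) / 2) (3 * T / 4)
  have ha : 0 < a := lt_min (half_pos hxI.1) (by positivity)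
  have hb : b < T := max_lt (by linarith [hxI.2]) (by linarith)
  have hab : a ≤ b := (min_le_right _ _).trans (le_trans (by linarith) (le_max_right _ _))
  have hsupp : ∀ t, t ∉ Ioo a b → ρ t - η.normed volume t = 0 := fun t ht => by
    have h1 : ρ t = 0 := by
      by_contra h0
      have : x - t ∈ Metric.ball (0 : ℝ) (φ n).rOut := by
        rw [← (φ n).support_normed_eq (μ := volume)]
        exact h0
      rw [mem_ball_zero_iff, Real.norm_eq_abs, abs_lt] at this
      refine ht ⟨(min_le_left _ _).trans_lt ?_, lt_of_lt_of_le ?_ (le_max_left _ _)⟩ <;> linarith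
    have h2 : η.normed volume t = 0 := by
      by_contra h0
      have : t ∈ Metric.ball (T / 2) η.rOut := by
        rw [← η.support_normed_eq (μ := volume)]
        exact h0
      rw [Metric.mem_ball, Real.dist_eq, abs_lt] at this
      simp only [η] at this
      refine ht ⟨(min_le_right _ _).trans_lt ?_, lt_of_lt_of_le ?_ (le_max_right _ _)⟩ <;> linarith
    rw [h1, h2, sub_zero]
  obtain ⟨G, hG, hGc, hGs, hGb, hGd⟩ := exists_primitive (g := fun t => ρ t - η.normed volume t)
    (hρs.sub η.contDiff_normed) ha hab hb hsupp (by
      rw [integral_sub hρi hηi, hρ1, η.integral_normed, sub_self])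
  have hL1 : ∫ s, |ρ s - η.normed volume s| ≤ 2 := by
    calc ∫ s, |ρ s - η.normed volume s| ≤ ∫ s, (ρ s + η.normed volume s) := by
          refine integral_mono (hρi.sub hηi).abs (hρi.add hηi) fun s => ?_
          refine (abs_sub _ _).trans (le_of_eq ?_)
          rw [abs_of_nonneg ((φ n).nonneg_normed _), abs_of_nonneg (η.nonneg_normed _)]
      _ = 2 := by
          rw [integral_add hρi hηi, hρ1, η.integral_normed]
          norm_num
  have hmain := h.coord_bound i hG hGc hGs (C := 2) fun t => (hGb t).trans hL1
  have hfρ : Integrable (fun t => f t * ρ t) := by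
    obtain ⟨c, hc⟩ := (φ n).hasCompactSupport_normed.exists_bound_of_continuous
      ((φ n).continuous_normed (μ := volume))
    exact hf.mul_bdd (c := c) hρs.continuous.aestronglyMeasurable
      (Eventually.of_forall fun t => hc (x - t))
  have hfη : Integrable (fun t => f t * η.normed volume t) := by
    obtain ⟨c, hc⟩ := η.hasCompactSupport_normed.exists_bound_of_continuous
      (η.continuous_normed (μ := volume))
    exact hf.mul_bdd (c := c) η.continuous_normed.aestronglyMeasurable
      (Eventually.of_forall hc)
  have heq : ∫ t in Ioo 0 T, (u t) i * deriv G t =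
      (∫ t, f t * ρ t) - ∫ t, f t * η.normed volume t := by
    rw [← integral_sub hfρ hfη, ← integral_indicator measurableSet_Ioo]
    congr 1
    ext t
    by_cases ht : t ∈ Ioo 0 T
    · simp only [f, indicator_of_mem ht, hGd]
      ring
    · simp only [f, indicator_of_notMem ht]
      ring
  have hc : (((φ n).normed volume ⋆[ContinuousLinearMap.lsmul ℝ ℝ, volume] f) x) =
      ∫ t, f t * ρ t := by
    rw [convolution_eq_swap]
    congr 1
    ext t
    simp [ρ, mul_comm]
  rw [hc]
  rw [heq] at hmain
  have := abs_sub_abs_le_abs_sub (∫ t, f t * ρ t) (∫ t, f t * η.normed volume t)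
  linarith

/-- The embedding of `BV((0, T); ℝ^d)` into `L²((0, T); ℝ^d)`. -/
lemma memLp_two_of_mem_BV {T : ℝ} {d : ℕ} {u : Lp (Vec d) 1 (vol T)} (hu : u ∈ BV T d) :
    MemLp u 2 (vol T) := by
  obtain ⟨q, hq⟩ := hu
  rcases le_or_gt T 0 with hT | hT
  · refine MemLp.of_bound (Lp.aestronglyMeasurable u) 0 ?_
    rw [ae_restrict_iff' measurableSet_Ioo]
    exact Eventually.of_forall fun t ht => absurd (ht.1.trans ht.2) (not_lt.2 hT)
  · choose M hM using hq.coord_ae_bounded hT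
    refine MemLp.of_bound (Lp.aestronglyMeasurable u) (∑ i, M i) ?_
    filter_upwards [ae_all_iff.2 hM] with t ht
    conv_lhs => rw [← (EuclideanSpace.basisFun (Fin d) ℝ).sum_repr (u t)]
    refine (norm_sum_le _ _).trans (Finset.sum_le_sum fun i _ => ?_)
    rw [norm_smul]
    simpa using ht i

/-- A function of bounded variation, as an element of `L²((0, T); ℝ^d)`. -/
noncomputable def toL2 {T : ℝ} {d : ℕ} (u : BV T d) : Lp (Vec d) 2 (vol T) :=
  (memLp_two_of_mem_BV u.2).toLp u

/-- The objective functional `j(u) = F(K u) + β ‖u'‖`. -/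
noncomputable def objective {T : ℝ} {d : ℕ} {Y : Type*} [NormedAddCommGroup Y]
    [InnerProductSpace ℝ Y] (K : Lp (Vec d) 2 (vol T) →L[ℝ] Y) (F : Y → ℝ) (β : ℝ)
    (u : BV T d) : ℝ :=
  F (K (toL2 u)) + β * mnorm (distribDeriv u)

/-- A functional on `BV((0, T); ℝ^d)` is radially unbounded if it tends to `+∞` along all sequences
whose `BV` norm tends to infinity. -/
def RadiallyUnbounded {T : ℝ} {d : ℕ} (j : BV T d → ℝ) : Prop :=
  ∀ u : ℕ → BV T d, Tendsto (fun k => bvNorm (u k)) atTop atTop →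
    Tendsto (fun k => j (u k)) atTop atTop

end BVMin

namespace BVMin

open scoped CompactlySupported

/-! This is the direct method, with an ultrafilter `U` containing every sublevel set `{u | j u ≤ j
v}` in place of a minimizing sequence. Radial unboundedness bounds the `BV` norm on such a set,
hence the `L²` norm (`exists_norm_toL2_le`), so the functions converge weakly in `L²` to some `w`
(`exists_weak_limit`), their derivatives converge weak-* (`exists_limit_vmeas`), and the norms of
the derivatives converge to some `m`. The equation defining the distributional derivative is linear
in both, so `w` is in `BV`, and the norm of its derivative is at most `m` because test functions
compute that norm (`exists_BV_limit`). For the other term, `F` lies above its tangent at `K w`. The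
tangent composed with `K` is affine and continuous, so it passes to the weak limit, and `j w ≤ j v`
follows for every `v`. Weak-* compactness of vector measures is reduced to positive measures: the
Jordan parts of each coordinate have mass at most the dual norm, and the Riesz–Markov theorem
represents the limits. -/

/-! ### Positive measures: weak-* limits and mutual singularity -/

/-- A real function on a set in an ultrafilter, if bounded there, converges along the ultrafilter. -/
lemma exists_tendsto_of_eventually_abs_le {ι : Type*} {U : Ultrafilter ι} {a : ι → ℝ} {M : ℝ}
    (h : ∀ᶠ i in (U : Filter ι), |a i| ≤ M) : ∃ x, Tendsto a U (𝓝 x) := by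
  have hU : ((U.map a : Ultrafilter ℝ) : Filter ℝ) ≤ 𝓟 (Icc (-M) M) := by
    rw [le_principal_iff]
    exact h.mono fun i hi => abs_le.1 hi
  obtain ⟨x, -, hx⟩ := isCompact_Icc.ultrafilter_le_nhds (U.map a) hU
  exact ⟨x, hx⟩

/-- Weak-* compactness of bounded sets of positive measures: along an ultrafilter, measures of
bounded mass converge against compactly supported functions. -/
lemma exists_limit_measure {X ι : Type*} [TopologicalSpace X] [T2Space X] [LocallyCompactSpace X]
    [MeasurableSpace X] [BorelSpace X] {U : Ultrafilter ι} {μ : ι → Measure X}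
    [∀ i, IsFiniteMeasure (μ i)] {M : ℝ} (h : ∀ᶠ i in (U : Filter ι), (μ i).real univ ≤ M) :
    ∃ ν : Measure X, IsFiniteMeasure ν ∧
      ∀ f : C_c(X, ℝ), Tendsto (fun i => ∫ x, f x ∂(μ i)) U (𝓝 (∫ x, f x ∂ν)) := by
  have hint : ∀ (f : C_c(X, ℝ)) i, Integrable f (μ i) := fun f i =>
    f.continuous.integrable_of_hasCompactSupport f.hasCompactSupport
  have hlim : ∀ f : C_c(X, ℝ), ∃ l, Tendsto (fun i => ∫ x, f x ∂(μ i)) U (𝓝 l) := fun f => by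
    obtain ⟨C, hC⟩ := f.hasCompactSupport.exists_bound_of_continuous f.continuous
    -- `|C|` instead of `C`: on an empty space `C` could be negative.
    refine exists_tendsto_of_eventually_abs_le (M := |C| * M) (h.mono fun i hi => ?_)
    have := norm_integral_le_of_norm_le_const (μ := μ i)
      (Eventually.of_forall fun x => (hC x).trans (le_abs_self C))
    rw [Real.norm_eq_abs] at this
    exact this.trans (mul_le_mul_of_nonneg_left hi (abs_nonneg C))
  choose l hl using hlim
  -- Linearity and positivity survive the limit, so Riesz–Markov applies.
  let Λ : C_c(X, ℝ) →ₚ[ℝ] ℝ := PositiveLinearMap.mk₀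
    { toFun := l
      map_add' := fun f g => tendsto_nhds_unique (hl (f + g)) (by
        simpa only [CompactlySupportedContinuousMap.add_apply, integral_add (hint f _) (hint g _)]
          using (hl f).add (hl g))
      map_smul' := fun c f => tendsto_nhds_unique (hl (c • f)) (by
        simpa only [CompactlySupportedContinuousMap.smul_apply, smul_eq_mul, integral_const_mul,
          RingHom.id_apply] using (hl f).const_mul c) }
    (fun f hf => ge_of_tendsto' (hl f) fun i => integral_nonneg fun x => hf x)
  refine ⟨RealRMK.rieszMeasure Λ, ⟨?_⟩, fun f => by
    rw [RealRMK.integral_rieszMeasure]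
    exact hl f⟩
  -- The constant 1 need not be an admissible test function, so the mass is bounded on compact sets
  -- by cutoffs, then on the whole space by inner regularity.
  have hK : ∀ K : Set X, IsCompact K → RealRMK.rieszMeasure Λ K ≤ ENNReal.ofReal M := by
    intro K hK
    obtain ⟨f, hf1, hfc, -, hf⟩ :=
      exists_continuousMap_one_of_isCompact_subset_isOpen hK isOpen_univ (subset_univ K)
    let g : C_c(X, ℝ) := ⟨f, hfc⟩
    refine (RealRMK.rieszMeasure_le_of_eq_one Λ (f := g) (fun x => (hf x).1) hK
      fun x hx => hf1 hx).trans (ENNReal.ofReal_le_ofReal ?_)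
    refine le_of_tendsto (hl g) (h.mono fun i hi => ?_)
    calc ∫ x, g x ∂(μ i) ≤ ∫ _, (1 : ℝ) ∂(μ i) :=
          integral_mono (hint g i) (integrable_const 1) fun x => (hf x).2
      _ ≤ M := by simpa using hi
  rw [isOpen_univ.measure_eq_iSup_isCompact]
  exact (iSup₂_le fun K _ => iSup_le fun hKc => hK K hKc).trans_lt ENNReal.ofReal_lt_top

/-- If the difference of two mutually singular measures is bounded by `m` as a functional on
compactly supported functions, then the mass of the first one is at most `m`. -/
lemma measureReal_univ_le_of_mutuallySingular {X : Type*} [TopologicalSpace X] [T2Space X]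
    [LocallyCompactSpace X] [MeasurableSpace X] [BorelSpace X] {μ ν : Measure X}
    [IsFiniteMeasure μ] [IsFiniteMeasure ν] [μ.InnerRegularCompactLTTop] [ν.OuterRegular]
    (hs : μ ⟂ₘ ν) {m : ℝ}
    (h : ∀ f : C_c(X, ℝ), (∀ x, |f x| ≤ 1) → ∫ x, f x ∂μ - ∫ x, f x ∂ν ≤ m) :
    μ.real univ ≤ m := by
  refine le_of_forall_pos_le_add fun ε hε => ?_
  -- `Sᶜ` carries `μ` and is `ν`-null. A cutoff equal to 1 on a compact `K ⊆ Sᶜ` with almost full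
  -- `μ`-mass, supported in an open `V ⊇ K` of small `ν`-mass, nearly integrates to `μ univ` against
  -- `μ - ν`.
  obtain ⟨S, hS, hμS, hνS⟩ := hs
  obtain ⟨K, hKS, hK, hμK⟩ := hS.compl.exists_isCompact_sdiff_lt (measure_ne_top μ Sᶜ)
    (ENNReal.ofReal_pos.2 (half_pos hε)).ne'
  obtain ⟨V, hKV, hV, hνV⟩ := K.exists_isOpen_lt_of_lt (μ := ν) (ENNReal.ofReal (ε / 2))
    ((measure_mono hKS).trans_lt (by rw [hνS]; exact ENNReal.ofReal_pos.2 (half_pos hε)))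
  obtain ⟨f, hf1, hfc, hfV, hf⟩ := exists_continuousMap_one_of_isCompact_subset_isOpen hK hV hKV
  let g : C_c(X, ℝ) := ⟨f, hfc⟩
  have hμi : Integrable g μ := g.continuous.integrable_of_hasCompactSupport g.hasCompactSupport
  have hνi : Integrable g ν := g.continuous.integrable_of_hasCompactSupport g.hasCompactSupport
  have h1 : μ.real univ ≤ μ.real K + ε / 2 := by
    have hsub : (univ : Set X) ⊆ K ∪ ((Sᶜ \ K) ∪ S) := fun x _ => by
      by_cases hxS : x ∈ S
      · exact Or.inr (Or.inr hxS)
      · by_cases hxK : x ∈ K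
        · exact Or.inl (hxK)
        · exact Or.inr (Or.inl ⟨hxS, hxK⟩)
    have h2 : μ.real (Sᶜ \ K) ≤ ε / 2 :=
      ENNReal.toReal_le_of_le_ofReal (half_pos hε).le hμK.le
    have h3 : μ.real S = 0 := by simp [measureReal_def, hμS]
    have := (measureReal_mono (μ := μ) hsub).trans (measureReal_union_le _ _)
    have := measureReal_union_le (μ := μ) (Sᶜ \ K) S
    linarith
  have h2 : μ.real K ≤ ∫ x, g x ∂μ := by
    rw [← integral_indicator_one hK.measurableSet]
    refine integral_mono ((integrable_const 1).indicator hK.measurableSet) hμi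
      fun x => ?_
    by_cases hx : x ∈ K
    · rw [indicator_of_mem hx]
      exact (hf1 hx).ge
    · rw [indicator_of_notMem hx]
      exact (hf x).1
  have h3 : ∫ x, g x ∂ν ≤ ε / 2 := by
    calc ∫ x, g x ∂ν ≤ ∫ x, V.indicator 1 x ∂ν := by
          refine integral_mono hνi ((integrable_const 1).indicator hV.measurableSet) fun x => ?_
          by_cases hx : x ∈ V
          · rw [indicator_of_mem hx]
            exact (hf x).2
          · rw [indicator_of_notMem hx]
            exact (image_eq_zero_of_notMem_tsupport fun h => hx (hfV h)).le
      _ = ν.real V := integral_indicator_one hV.measurableSet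
      _ ≤ ε / 2 := ENNReal.toReal_le_of_le_ofReal (half_pos hε).le hνV.le
  have h4 := h g fun x => (abs_of_nonneg (hf x).1).trans_le (hf x).2
  linarith

/-! ### Vector measures in coordinates -/

/-- The vector measure `s eᵢ` for a signed measure `s` and the `i`-th unit vector `eᵢ`. -/
noncomputable def coordEmbed {X : Type*} [MeasurableSpace X] {d : ℕ} (i : Fin d)
    (s : SignedMeasure X) : VectorMeasure X (Vec d) :=
  s.mapRange (ContinuousLinearMap.toSpanSingleton ℝ
    (EuclideanSpace.single i (1 : ℝ) : Vec d)).toLinearMap.toAddMonoidHom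
    (ContinuousLinearMap.toSpanSingleton ℝ (EuclideanSpace.single i (1 : ℝ) : Vec d)).continuous

lemma coordEmbed_apply {X : Type*} [MeasurableSpace X] {d : ℕ} (i : Fin d)
    (s : SignedMeasure X) (E : Set X) :
    coordEmbed i s E = s E • (EuclideanSpace.single i (1 : ℝ) : Vec d) := rfl

/-- The `i`-th coordinate of a vector measure. -/
noncomputable def coordMeasure {X : Type*} [MeasurableSpace X] {d : ℕ} (i : Fin d)
    (q : VectorMeasure X (Vec d)) : SignedMeasure X :=
  q.mapRange (EuclideanSpace.proj i : Vec d →L[ℝ] ℝ).toLinearMap.toAddMonoidHom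
    (EuclideanSpace.proj i : Vec d →L[ℝ] ℝ).continuous

lemma coordMeasure_apply {X : Type*} [MeasurableSpace X] {d : ℕ} (i : Fin d)
    (q : VectorMeasure X (Vec d)) (E : Set X) : coordMeasure i q E = q E i := rfl

/-- The vector measure with coordinates `μᵢ - νᵢ`. -/
noncomputable def ofParts {X : Type*} [MeasurableSpace X] {d : ℕ} (μ ν : Fin d → Measure X)
    [∀ i, IsFiniteMeasure (μ i)] [∀ i, IsFiniteMeasure (ν i)] : VectorMeasure X (Vec d) :=
  ∑ i, (coordEmbed i (μ i).toSignedMeasure - coordEmbed i (ν i).toSignedMeasure)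

lemma ofParts_jordan {X : Type*} [MeasurableSpace X] {d : ℕ} (q : VectorMeasure X (Vec d)) :
    ofParts (fun i => (coordMeasure i q).toJordanDecomposition.posPart)
      (fun i => (coordMeasure i q).toJordanDecomposition.negPart) = q := by
  ext E hE : 1
  have h : ∀ i, (coordMeasure i q).toJordanDecomposition.posPart.toSignedMeasure E -
      (coordMeasure i q).toJordanDecomposition.negPart.toSignedMeasure E = q E i := fun i => by
    rw [← coordMeasure_apply]
    conv_rhs => rw [← (coordMeasure i q).toSignedMeasure_toJordanDecomposition]
    rfl
  ext j
  rw [← h j]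
  simp [ofParts, coordEmbed_apply, hE, Finset.sum_apply, Pi.single_apply]

/-- By the definition of the integral both sides agree on indicators. Both are additive and
continuous on `L¹(μ)`, so induction on integrable functions extends the equality. -/
lemma integral_coordEmbed {X : Type*} [MeasurableSpace X] {d : ℕ} (i : Fin d) (μ : Measure X)
    [IsFiniteMeasure μ] {φ : X → Vec d} (hφ : Integrable φ μ) :
    ∫ᵛ t, φ t ∂[innerSL ℝ; coordEmbed i μ.toSignedMeasure] = ∫ t, φ t i ∂μ := by
  have hle : (coordEmbed i μ.toSignedMeasure).variation ≤ μ := by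
    refine VectorMeasure.variation_le_of_forall_enorm_le fun E hE => ?_
    rw [coordEmbed_apply, enorm_smul, Measure.toSignedMeasure_apply_measurable hE]
    simp [measureReal_def, Real.enorm_eq_ofReal ENNReal.toReal_nonneg, enorm_eq_nnnorm]
  have hint : ∀ {f : X → Vec d}, Integrable f μ →
      (coordEmbed i μ.toSignedMeasure).Integrable f := fun hf => hf.mono_measure hle
  refine Integrable.induction (fun f => ∫ᵛ t, f t ∂[innerSL ℝ; coordEmbed i μ.toSignedMeasure] =
    ∫ t, f t i ∂μ) ?_ ?_ ?_ ?_ hφ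
  · intro c s hs _
    rw [VectorMeasure.integral_eq_setToFun, setToFun_indicator_const _ hs (by finiteness)]
    have : (fun t => (s.indicator (fun _ => c) t) i) = s.indicator fun _ => c i := by
      ext t
      by_cases ht : t ∈ s <;> simp [ht]
    rw [this, integral_indicator_const _ hs]
    change inner ℝ c (coordEmbed i μ.toSignedMeasure s) = _
    rw [coordEmbed_apply, Measure.toSignedMeasure_apply_measurable hs, inner_smul_right]
    simp [EuclideanSpace.inner_single_right]
  · intro f g _ hf hg h1 h2
    rw [VectorMeasure.integral_add (hint hf) (hint hg), h1, h2]
    exact (integral_add ((EuclideanSpace.proj i : Vec d →L[ℝ] ℝ).integrable_comp hf)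
      ((EuclideanSpace.proj i : Vec d →L[ℝ] ℝ).integrable_comp hg)).symm
  · have h1 : ∀ f : X →₁[μ] Vec d, ∫ t, f t i ∂μ = (∫ t, f t ∂μ) i := fun f =>
      (EuclideanSpace.proj i : Vec d →L[ℝ] ℝ).integral_comp_comm (L1.integrable_coeFn f)
    simp only [h1]
    refine isClosed_eq ?_ ((EuclideanSpace.proj i : Vec d →L[ℝ] ℝ).continuous.comp
      continuous_integral)
    -- Since `μ` dominates the variation, the integral can be written as a `setToFun` over `μ`
    -- itself, which is continuous in the `L¹(μ)` norm.
    let T := (coordEmbed i μ.toSignedMeasure).transpose (innerSL ℝ : Vec d →L[ℝ] Vec d →L[ℝ] ℝ)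
    have hT : DominatedFinMeasAdditive μ T ‖(innerSL ℝ : Vec d →L[ℝ] Vec d →L[ℝ] ℝ)‖ :=
      (dominatedFinMeasAdditive_cbmApplyMeasure _ _).of_measure_le hle (by positivity)
    have h2 : ∀ f : X →₁[μ] Vec d,
        ∫ᵛ t, f t ∂[innerSL ℝ; coordEmbed i μ.toSignedMeasure] = setToFun μ T hT f := fun f => by
      rw [VectorMeasure.integral_eq_setToFun]
      exact (setToFun_congr_measure_of_integrable 1 (by simp) (by simpa using hle) hT _ _
        (L1.integrable_coeFn f)).symm
    simp only [h2]
    exact continuous_setToFun hT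
  · intro f g hfg hf h
    rw [← VectorMeasure.integral_congr_ae (hle.absolutelyContinuous.ae_eq hfg), h]
    exact integral_congr_ae (hfg.mono fun t ht => by simp only [ht])

/-- The pairing with a vector measure, in terms of its coordinates. -/
lemma pairing_ofParts {T : ℝ} {d : ℕ} (μ ν : Fin d → Measure (Ioo (0 : ℝ) T))
    [∀ i, IsFiniteMeasure (μ i)] [∀ i, IsFiniteMeasure (ν i)] {φ : Ioo (0 : ℝ) T → Vec d}
    (hφ : Continuous φ) {C : ℝ} (hC : ∀ t, ‖φ t‖ ≤ C) :
    pairing φ (ofParts μ ν) = ∑ i, (∫ t, φ t i ∂(μ i) - ∫ t, φ t i ∂(ν i)) := by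
  have hb : ∀ (m : Measure (Ioo (0 : ℝ) T)) [IsFiniteMeasure m], Integrable φ m := fun m _ =>
    Integrable.of_bound hφ.aestronglyMeasurable C (Eventually.of_forall hC)
  unfold pairing ofParts
  rw [VectorMeasure.integral_finsetSum_vectorMeasure fun i _ => hb _]
  refine Finset.sum_congr rfl fun i _ => ?_
  rw [VectorMeasure.integral_sub_vectorMeasure (hb _) (hb _), integral_coordEmbed i _ (hb _),
    integral_coordEmbed i _ (hb _)]

instance locallyCompactSpace_Ioo (a b : ℝ) : LocallyCompactSpace (Ioo a b) :=
  isOpen_Ioo.locallyCompactSpace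

/-- The function `f eᵢ` for a scalar function `f` and the `i`-th unit vector `eᵢ`. -/
noncomputable def singleC0 {T : ℝ} {d : ℕ} (i : Fin d) (f : C_c(Ioo (0 : ℝ) T, ℝ)) :
    C₀(Ioo (0 : ℝ) T, Vec d) where
  toFun t := f t • EuclideanSpace.single i (1 : ℝ)
  continuous_toFun := f.continuous.smul continuous_const
  zero_at_infty' := by
    have : HasCompactSupport fun t => f t • (EuclideanSpace.single i (1 : ℝ) : Vec d) :=
      f.hasCompactSupport.smul_right
    exact this.is_zero_at_infty

/-! ### The dual norm and weak-* compactness of vector measures -/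

lemma norm_C0_le {T : ℝ} {d : ℕ} {φ : C₀(Ioo (0 : ℝ) T, Vec d)} {C : ℝ} (hC : 0 ≤ C)
    (h : ∀ t, ‖φ t‖ ≤ C) : ‖φ‖ ≤ C :=
  (BoundedContinuousFunction.norm_le (f := φ.toBCF) hC).2 h

lemma abs_pairing_le_mnorm {T : ℝ} {d : ℕ} (q : VMeas T d) (φ : C₀(Ioo (0 : ℝ) T, Vec d)) {C : ℝ}
    (hC : 0 ≤ C) (h : ∀ t, ‖φ t‖ ≤ C) : |pairing φ q| ≤ mnorm q * C :=
  ((toDual q).le_opNorm φ).trans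
    (mul_le_mul_of_nonneg_left (norm_C0_le hC h) (norm_nonneg _))

lemma mnorm_nonneg {T : ℝ} {d : ℕ} (q : VMeas T d) : 0 ≤ mnorm q :=
  norm_nonneg (toDual q)

/-- The test function `f eᵢ` has supremum norm at most one and sees the `i`-th coordinate alone. -/
lemma abs_integral_jordan_le {T : ℝ} {d : ℕ} (q : VMeas T d) (i : Fin d)
    {f : C_c(Ioo (0 : ℝ) T, ℝ)} (hf : ∀ t, |f t| ≤ 1) :
    |∫ t, f t ∂(coordMeasure i q).toJordanDecomposition.posPart -
      ∫ t, f t ∂(coordMeasure i q).toJordanDecomposition.negPart| ≤ mnorm q := by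
  have hb : ∀ t, ‖singleC0 i f t‖ ≤ 1 := fun t => by
    change ‖f t • (EuclideanSpace.single i (1 : ℝ) : Vec d)‖ ≤ 1
    rw [norm_smul]
    simpa using hf t
  have h := abs_pairing_le_mnorm q (singleC0 i f) zero_le_one hb
  rw [mul_one] at h
  conv_lhs at h => rw [← ofParts_jordan q]
  rw [pairing_ofParts _ _ (map_continuous (singleC0 i f)) hb, Finset.sum_eq_single i] at h
  · simpa [singleC0] using h
  · intro j _ hj
    simp [singleC0, hj]
  · simp

/-- Mutual singularity rules out cancellation between the Jordan parts, so a bound on their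
difference bounds each of them. This feeds `exists_limit_measure`, which needs bounded masses. -/
lemma posPart_univ_le_mnorm {T : ℝ} {d : ℕ} (q : VMeas T d) (i : Fin d) :
    (coordMeasure i q).toJordanDecomposition.posPart.real univ ≤ mnorm q :=
  measureReal_univ_le_of_mutuallySingular (coordMeasure i q).toJordanDecomposition.mutuallySingular
    fun _ hf => (abs_le.1 (abs_integral_jordan_le q i hf)).2

lemma negPart_univ_le_mnorm {T : ℝ} {d : ℕ} (q : VMeas T d) (i : Fin d) :
    (coordMeasure i q).toJordanDecomposition.negPart.real univ ≤ mnorm q :=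
  measureReal_univ_le_of_mutuallySingular
    (coordMeasure i q).toJordanDecomposition.mutuallySingular.symm
    fun _ hf => by linarith [(abs_le.1 (abs_integral_jordan_le q i hf)).1]

/-- Weak-* compactness of bounded sets of vector measures. -/
lemma exists_limit_vmeas {ι : Type*} {U : Ultrafilter ι} {T : ℝ} {d : ℕ} {q : ι → VMeas T d}
    {M : ℝ} (h : ∀ᶠ k in (U : Filter ι), mnorm (q k) ≤ M) :
    ∃ p : VMeas T d, ∀ φ : Ioo (0 : ℝ) T → Vec d, Continuous φ → HasCompactSupport φ →
      Tendsto (fun k => pairing φ (q k)) U (𝓝 (pairing φ p)) := by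
  have hpos := fun i : Fin d => exists_limit_measure (U := U)
    (μ := fun k => (coordMeasure i (q k)).toJordanDecomposition.posPart)
    (h.mono fun k hk => (posPart_univ_le_mnorm (q k) i).trans hk)
  have hneg := fun i : Fin d => exists_limit_measure (U := U)
    (μ := fun k => (coordMeasure i (q k)).toJordanDecomposition.negPart)
    (h.mono fun k hk => (negPart_univ_le_mnorm (q k) i).trans hk)
  choose μ hμ1 hμ using hpos
  choose ν hν1 hν using hneg
  refine ⟨ofParts μ ν, fun φ hφ hc => ?_⟩
  obtain ⟨C, hC⟩ := hc.exists_bound_of_continuous hφ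
  have hq : ∀ k, pairing φ (q k) =
      ∑ i, (∫ t, φ t i ∂(coordMeasure i (q k)).toJordanDecomposition.posPart -
        ∫ t, φ t i ∂(coordMeasure i (q k)).toJordanDecomposition.negPart) := fun k => by
    conv_lhs => rw [← ofParts_jordan (q k)]
    exact pairing_ofParts _ _ hφ hC
  simp only [hq, pairing_ofParts μ ν hφ hC]
  refine tendsto_finsetSum _ fun i _ => ?_
  let f : C_c(Ioo (0 : ℝ) T, ℝ) :=
    ⟨⟨fun t => φ t i, (EuclideanSpace.proj i : Vec d →L[ℝ] ℝ).continuous.comp hφ⟩,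
      hc.comp_left (g := fun v : Vec d => v i) rfl⟩
  exact (hμ i f).sub (hν i f)

/-! ### Density of test functions -/

lemma norm_apply_le_norm {T : ℝ} {d : ℕ} (f : C₀(Ioo (0 : ℝ) T, Vec d)) (t : Ioo (0 : ℝ) T) :
    ‖f t‖ ≤ ‖f‖ := f.toBCF.norm_coe_le_norm t

/-- Test functions are dense in the continuous functions vanishing at the boundary. -/
lemma exists_isTest_near {T : ℝ} {d : ℕ} (f : C₀(Ioo (0 : ℝ) T, Vec d)) {ε : ℝ} (hε : 0 < ε) :
    ∃ φ : ℝ → Vec d, IsTest T φ ∧ ∀ t : Ioo (0 : ℝ) T, ‖φ t - f t‖ ≤ ε := by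
  -- Off `K` the function is already below `ε / 2`, so multiplying by a cutoff that is 1 on `K`
  -- costs at most `ε / 2`; smoothing costs the other half.
  obtain ⟨K, hK, hKf⟩ := (hasBasis_cocompact.tendsto_iff Metric.nhds_basis_ball).1
    f.zero_at_infty' (ε / 2) (half_pos hε)
  obtain ⟨χ, hχ1, hχc, -, hχ⟩ :=
    exists_continuousMap_one_of_isCompact_subset_isOpen hK isOpen_univ (subset_univ K)
  let h : Ioo (0 : ℝ) T → Vec d := fun t => χ t • f t
  have hh : Continuous h := χ.continuous.smul (map_continuous f)
  have hhc : HasCompactSupport h := HasCompactSupport.smul_right (f := χ) hχc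
  let g : ℝ → Vec d := Function.extend Subtype.val h 0
  have hg : Continuous g := HasCompactSupport.continuous_extend_zero isOpen_Ioo hh hhc
  have hgc : HasCompactSupport g := hhc.extend_zero continuous_subtype_val
  have hgs : tsupport g ⊆ Ioo 0 T :=
    (hhc.tsupport_extend_zero_subset continuous_subtype_val).trans (Subtype.coe_image_subset _ _)
  have hgh : ∀ t : Ioo (0 : ℝ) T, g t = h t := fun t => Subtype.val_injective.extend_apply h 0 t
  -- `δ₁` controls the smoothing error, `δ₂` keeps the smoothed support inside the interval.
  obtain ⟨δ₁, hδ₁, hδ₁g⟩ := Metric.uniformContinuous_iff.1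
    (hgc.uniformContinuous_of_continuous hg) (ε / 2) (half_pos hε)
  obtain ⟨δ₂, hδ₂, hδ₂g⟩ := hgc.isCompact.exists_cthickening_subset_open isOpen_Ioo hgs
  obtain ⟨φ, hφ, hφg⟩ :=
    hg.exists_contDiff_dist_le_of_forall_mem_ball_dist_le (lt_min hδ₁ hδ₂)
  have hsupp : tsupport φ ⊆ Metric.cthickening δ₂ (tsupport g) := by
    refine closure_minimal (fun a ha => ?_) Metric.isClosed_cthickening
    by_contra hn
    -- The smoothing error at `a` is bounded by the oscillation of `g` near `a`; where `g` vanishes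
    -- on the whole ball, `φ a` must vanish too.
    have h0 : ∀ x ∈ Metric.ball a (min δ₁ δ₂), g x = 0 := fun x hx =>
      image_eq_zero_of_notMem_tsupport fun hxs => hn
        (Metric.mem_cthickening_of_dist_le a x δ₂ _ hxs
          ((Metric.mem_ball'.1 hx).le.trans (min_le_right _ _)))
    have ha0 : g a = 0 := h0 a (Metric.mem_ball_self (lt_min hδ₁ hδ₂))
    have := hφg a 0 fun x hx => by rw [h0 x hx, ha0, dist_self]
    rw [ha0, dist_zero_right] at this
    exact ha (norm_le_zero_iff.1 this)
  refine ⟨φ, ⟨hφ, hgc.isCompact.cthickening.of_isClosed_subset (isClosed_tsupport _) hsupp,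
    hsupp.trans hδ₂g⟩, fun t => ?_⟩
  have h1 : ‖φ t - g t‖ ≤ ε / 2 := by
    rw [← dist_eq_norm]
    exact hφg t _ fun x hx => (hδ₁g ((Metric.mem_ball.1 hx).trans_le (min_le_left _ _))).le
  have h2 : ‖g t - f t‖ ≤ ε / 2 := by
    rw [hgh]
    by_cases ht : t ∈ K
    · have : h t = f t := by simp [h, hχ1 ht]
      rw [this, sub_self, norm_zero]
      exact (half_pos hε).le
    · have hf : ‖f t‖ ≤ ε / 2 := (mem_ball_zero_iff.1 (hKf t ht)).le
      have : h t - f t = (χ t - 1) • f t := by simp [h, sub_smul]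
      rw [this, norm_smul, Real.norm_eq_abs]
      refine (mul_le_of_le_one_left (norm_nonneg _) (abs_le.2 ?_)).trans hf
      constructor <;> linarith [(hχ t).1, (hχ t).2]
  calc ‖φ t - f t‖ ≤ ‖φ t - g t‖ + ‖g t - f t‖ := norm_sub_le_norm_sub_add_norm_sub _ _ _
    _ ≤ ε := by linarith

lemma IsTest.continuous_restrict {T : ℝ} {d : ℕ} {φ : ℝ → Vec d} (hφ : IsTest T φ) :
    Continuous fun t : Ioo (0 : ℝ) T => φ t := hφ.smooth.continuous.comp continuous_subtype_val

lemma IsTest.hasCompactSupport_restrict {T : ℝ} {d : ℕ} {φ : ℝ → Vec d} (hφ : IsTest T φ) :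
    HasCompactSupport fun t : Ioo (0 : ℝ) T => φ t := by
  have hK : IsCompact ((↑) ⁻¹' tsupport φ : Set (Ioo (0 : ℝ) T)) :=
    Topology.IsInducing.subtypeVal.isCompact_preimage' hφ.compact.isCompact
      (by rw [Subtype.range_coe]; exact hφ.supp)
  exact HasCompactSupport.intro hK fun t ht => image_eq_zero_of_notMem_tsupport ht

/-- A test function, as a continuous function vanishing at the boundary. -/
noncomputable def IsTest.toC0 {T : ℝ} {d : ℕ} {φ : ℝ → Vec d} (hφ : IsTest T φ) :
    C₀(Ioo (0 : ℝ) T, Vec d) where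
  toFun t := φ t
  continuous_toFun := hφ.continuous_restrict
  zero_at_infty' := hφ.hasCompactSupport_restrict.is_zero_at_infty

/-- The norm of a vector measure can be computed with test functions. -/
lemma mnorm_le_of_forall_isTest {T : ℝ} {d : ℕ} {q : VMeas T d} {m : ℝ} (hm : 0 ≤ m)
    (h : ∀ φ : ℝ → Vec d, IsTest T φ → ∀ C, 0 ≤ C → (∀ t : Ioo (0 : ℝ) T, ‖φ t‖ ≤ C) →
      |pairing (fun t => φ t) q| ≤ m * C) : mnorm q ≤ m := by
  refine ContinuousLinearMap.opNorm_le_bound _ hm fun f => le_of_forall_pos_le_add fun ε hε => ?_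
  have hq := mnorm_nonneg q
  -- Replacing `f` by `φ` costs `m * δ` in the norm of the test function and `mnorm q * δ` in the
  -- pairing; this denominator makes the total at most `ε`, and the 1 keeps it positive.
  have hpos : 0 < m + mnorm q + 1 := by positivity
  obtain ⟨φ, hφ, hφf⟩ := exists_isTest_near f (div_pos hε hpos)
  set δ := ε / (m + mnorm q + 1) with hδ
  have hδ0 : 0 < δ := div_pos hε hpos
  have hδε : (m + mnorm q + 1) * δ = ε := mul_div_cancel₀ _ hpos.ne'
  have h1 : |toDual q hφ.toC0| ≤ m * (‖f‖ + δ) := h φ hφ _ (by positivity) fun t => by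
    calc ‖φ t‖ ≤ ‖f t‖ + ‖φ t - f t‖ := norm_le_norm_add_norm_sub' _ _
      _ ≤ ‖f‖ + δ := add_le_add (norm_apply_le_norm f t) (hφf t)
  have h2 : |toDual q (f - hφ.toC0)| ≤ mnorm q * δ :=
    abs_pairing_le_mnorm q (f - hφ.toC0) hδ0.le fun t => by
      rw [ZeroAtInftyContinuousMap.sub_apply, norm_sub_rev]
      exact hφf t
  rw [map_sub] at h2
  have h3 := abs_sub_abs_le_abs_sub (toDual q f) (toDual q hφ.toC0)
  rw [Real.norm_eq_abs]
  nlinarith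

/-! ### Bounded embedding of `BV` into `L^∞` and `L²` -/

/-- The pairings of a coordinate of `u` with the derivatives of scalar test functions are bounded
by the norm of the derivative. -/
lemma HasDistribDeriv.coord_bound_mnorm {T : ℝ} {d : ℕ} {u : Lp (Vec d) 1 (vol T)} {q : VMeas T d}
    (h : HasDistribDeriv u q) (i : Fin d) {G : ℝ → ℝ} (hG : ContDiff ℝ ∞ G)
    (hc : HasCompactSupport G) (hs : tsupport G ⊆ Ioo 0 T) {C : ℝ} (hC : ∀ t, |G t| ≤ C) :
    |∫ t in Ioo 0 T, (u t) i * deriv G t| ≤ mnorm q * C := by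
  let e : Vec d := EuclideanSpace.single i 1
  have ht : IsTest T (fun t => G t • e) :=
    { smooth := hG.smul contDiff_const
      compact := hc.smul_right
      supp := (closure_mono (Function.support_smul_subset_left G fun _ => e)).trans hs }
  have : (∫ t in Ioo 0 T, inner ℝ (u t) (deriv (fun t => G t • e) t)) =
      ∫ t in Ioo 0 T, (u t) i * deriv G t := by
    congr 1
    ext t
    rw [deriv_smul_const ((hG.differentiable (by simp)) t) e, inner_smul_right]
    simp [e, mul_comm, EuclideanSpace.inner_single_right]
  rw [← this, h _ ht, abs_neg]
  refine abs_pairing_le_mnorm q ht.toC0 ((abs_nonneg _).trans (hC 0)) fun t => ?_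
  change ‖G t • e‖ ≤ C
  rw [norm_smul]
  simpa [e] using hC t

lemma integrable_coord {T : ℝ} {d : ℕ} (u : Lp (Vec d) 1 (vol T)) (i : Fin d) :
    Integrable (fun t => (u t) i) (vol T) :=
  (EuclideanSpace.proj i : Vec d →L[ℝ] ℝ).integrable_comp (L1.integrable_coeFn u)

lemma abs_integral_coord_mul_le {T : ℝ} {d : ℕ} (u : Lp (Vec d) 1 (vol T)) (i : Fin d)
    {g : ℝ → ℝ} {C : ℝ} (hC : ∀ t, |g t| ≤ C) :
    |∫ t in Ioo 0 T, (u t) i * g t| ≤ C * ‖u‖ := by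
  rw [L1.norm_eq_integral_norm, ← integral_const_mul, ← Real.norm_eq_abs]
  refine norm_integral_le_of_norm_le ((L1.integrable_coeFn u).norm.const_mul C)
    (Eventually.of_forall fun t => ?_)
  rw [norm_mul, mul_comm]
  exact mul_le_mul (hC t) (PiLp.norm_apply_le (u t) i) (norm_nonneg _)
    ((abs_nonneg _).trans (hC t))

/-- The averages of the coordinates of a function of bounded variation are bounded by the
`BV` norm. -/
lemma exists_abs_average_le {T : ℝ} (hT : 0 < T) (d : ℕ) :
    ∃ M : ℝ, 0 ≤ M ∧ ∀ (u : Lp (Vec d) 1 (vol T)) (q : VMeas T d), HasDistribDeriv u q →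
      ∀ (i : Fin d) (ρ : ℝ → ℝ) (a b : ℝ), ContDiff ℝ ∞ ρ → (∀ t, 0 ≤ ρ t) → ∫ t, ρ t = 1 →
        0 < a → b < T → (∀ t, t ∉ Ioo a b → ρ t = 0) →
        |∫ t in Ioo 0 T, (u t) i * ρ t| ≤ M * (mnorm q + ‖u‖) := by
  -- A fixed reference bump. The difference `ρ - η.normed` has mean zero and `L¹` norm at most 2, so
  -- it is `G'` with `|G| ≤ 2` and contributes at most `2 * mnorm q`; the bump contributes at most
  -- `c * ‖u‖`. Neither constant depends on `ρ`.
  let η : ContDiffBump (T / 2) := ⟨T / 8, T / 4, by positivity, by linarith⟩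
  obtain ⟨c, hc⟩ := η.hasCompactSupport_normed.exists_bound_of_continuous
    (η.continuous_normed (μ := volume))
  have hc0 : 0 ≤ c := (norm_nonneg _).trans (hc 0)
  refine ⟨2 + c, by positivity, fun u q h i ρ a b hρ hρ0 hρ1 ha hb hsupp => ?_⟩
  have hρi : Integrable ρ := by
    by_contra hn
    rw [integral_undef hn] at hρ1
    exact zero_ne_one hρ1
  have hρb : ∃ C, ∀ t, ‖ρ t‖ ≤ C :=
    (HasCompactSupport.intro (isCompact_Icc (a := a) (b := b)) fun t ht =>
      hsupp t fun h => ht (Ioo_subset_Icc_self h)).exists_bound_of_continuous hρ.continuous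
  have hηi : Integrable (η.normed volume) := η.integrable_normed
  let a' := min a (T / 4)
  let b' := max b (3 * T / 4)
  have ha' : 0 < a' := lt_min ha (by positivity)
  have hb' : b' < T := max_lt hb (by linarith)
  have hab' : a' ≤ b' := (min_le_right _ _).trans (le_trans (by linarith) (le_max_right _ _))
  have hsupp' : ∀ t, t ∉ Ioo a' b' → ρ t - η.normed volume t = 0 := fun t ht => by
    have h1 : ρ t = 0 := hsupp t fun h =>
      ht ⟨(min_le_left _ _).trans_lt h.1, h.2.trans_le (le_max_left _ _)⟩
    have h2 : η.normed volume t = 0 := by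
      by_contra h0
      have : t ∈ Metric.ball (T / 2) η.rOut := by
        rw [← η.support_normed_eq (μ := volume)]
        exact h0
      rw [Metric.mem_ball, Real.dist_eq, abs_lt] at this
      simp only [η] at this
      refine ht ⟨(min_le_right _ _).trans_lt ?_, lt_of_lt_of_le ?_ (le_max_right _ _)⟩ <;> linarith
    rw [h1, h2, sub_zero]
  obtain ⟨G, hG, hGc, hGs, hGb, hGd⟩ := exists_primitive (g := fun t => ρ t - η.normed volume t)
    (hρ.sub η.contDiff_normed) ha' hab' hb' hsupp' (by
      rw [integral_sub hρi hηi, hρ1, η.integral_normed, sub_self])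
  have hL1 : ∫ s, |ρ s - η.normed volume s| ≤ 2 := by
    calc ∫ s, |ρ s - η.normed volume s| ≤ ∫ s, (ρ s + η.normed volume s) := by
          refine integral_mono (hρi.sub hηi).abs (hρi.add hηi) fun s => ?_
          refine (abs_sub _ _).trans (le_of_eq ?_)
          rw [abs_of_nonneg (hρ0 s), abs_of_nonneg (η.nonneg_normed _)]
      _ = 2 := by
          rw [integral_add hρi hηi, hρ1, η.integral_normed]
          norm_num
  have h1 := h.coord_bound_mnorm i hG hGc hGs (C := 2) fun t => (hGb t).trans hL1
  have h2 := abs_integral_coord_mul_le u i hc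
  have hu := integrable_coord u i
  have heq : ∫ t in Ioo 0 T, (u t) i * ρ t =
      (∫ t in Ioo 0 T, (u t) i * deriv G t) + ∫ t in Ioo 0 T, (u t) i * η.normed volume t := by
    obtain ⟨C, hC⟩ := hρb
    have hi1 : Integrable (fun t => (u t) i * ρ t) (vol T) :=
      hu.mul_bdd (c := C) hρ.continuous.aestronglyMeasurable (Eventually.of_forall hC)
    have hi2 : Integrable (fun t => (u t) i * η.normed volume t) (vol T) :=
      hu.mul_bdd (c := c) η.continuous_normed.aestronglyMeasurable (Eventually.of_forall hc)
    rw [← sub_eq_iff_eq_add, ← integral_sub hi1 hi2]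
    congr 1
    ext t
    rw [hGd]
    ring
  rw [heq]
  have hq := mnorm_nonneg q
  have hn := norm_nonneg u
  calc _ ≤ _ := abs_add_le _ _
    _ ≤ mnorm q * 2 + c * ‖u‖ := add_le_add h1 h2
    _ ≤ (2 + c) * (mnorm q + ‖u‖) := by nlinarith [mul_nonneg hc0 hq]

/-- The embedding of `BV((0, T); ℝ^d)` into `L^∞((0, T); ℝ^d)` is bounded. -/
lemma exists_ae_abs_coord_le {T : ℝ} (hT : 0 < T) (d : ℕ) :
    ∃ M : ℝ, 0 ≤ M ∧ ∀ (u : Lp (Vec d) 1 (vol T)) (q : VMeas T d), HasDistribDeriv u q →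
      ∀ i : Fin d, ∀ᵐ t ∂(vol T), |(u t) i| ≤ M * (mnorm q + ‖u‖) := by
  obtain ⟨M, hM, hMu⟩ := exists_abs_average_le hT d
  refine ⟨M, hM, fun u q h i => ?_⟩
  let f : ℝ → ℝ := (Ioo 0 T).indicator fun t => (u t) i
  have hf : Integrable f := (integrable_indicator_iff measurableSet_Ioo).2 (integrable_coord u i)
  let φ : ℕ → ContDiffBump (0 : ℝ) := fun n =>
    ⟨1 / (n + 1), 2 / (n + 1), by positivity, by gcongr; norm_num⟩
  have hφ : Tendsto (fun n => (φ n).rOut) atTop (𝓝 0) := by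
    have := (tendsto_one_div_add_atTop_nhds_zero_nat (𝕜 := ℝ)).const_mul 2
    simpa only [φ, mul_one_div, mul_zero] using this
  -- By Lebesgue differentiation, almost every value of the coordinate is a limit of smooth
  -- averages, which are uniformly bounded by `hMu`.
  have hconv := ContDiffBump.ae_convolution_tendsto_right_of_locallyIntegrable (μ := volume)
    (K := 2) hφ (Eventually.of_forall fun n => le_of_eq (by simp only [φ]; ring))
    hf.locallyIntegrable
  rw [ae_restrict_iff' measurableSet_Ioo]
  filter_upwards [hconv] with x hx hxI
  have hfx : f x = (u x) i := indicator_of_mem hxI _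
  rw [← hfx]
  refine le_of_tendsto hx.abs ?_
  have hx0 : 0 < min x (T - x) := lt_min hxI.1 (sub_pos.2 hxI.2)
  -- This radius puts the support of the averaging kernel in `(x / 2, (x + T) / 2)`, away from both
  -- endpoints.
  filter_upwards [hφ.eventually (gt_mem_nhds (half_pos hx0))] with n hn
  have hxl := min_le_left x (T - x)
  have hxr := min_le_right x (T - x)
  have key := hMu u q h i (fun t => (φ n).normed volume (x - t)) (x / 2) ((x + T) / 2)
    (((φ n).contDiff_normed (μ := volume)).comp (contDiff_const.sub contDiff_id))
    (fun t => (φ n).nonneg_normed _)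
    (by
      rw [integral_sub_left_eq_self (fun t => (φ n).normed volume t) volume x]
      exact (φ n).integral_normed)
    (half_pos hxI.1) (by linarith [hxI.2]) (fun t ht => by
      by_contra h0
      have : x - t ∈ Metric.ball (0 : ℝ) (φ n).rOut := by
        rw [← (φ n).support_normed_eq (μ := volume)]
        exact h0
      rw [mem_ball_zero_iff, Real.norm_eq_abs, abs_lt] at this
      exact ht ⟨by linarith, by linarith⟩)
  have hc : (((φ n).normed volume ⋆[ContinuousLinearMap.lsmul ℝ ℝ, volume] f) x) =
      ∫ t in Ioo 0 T, (u t) i * (φ n).normed volume (x - t) := by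
    rw [convolution_eq_swap, ← integral_indicator measurableSet_Ioo]
    congr 1
    ext t
    by_cases ht : t ∈ Ioo 0 T
    · simp only [f, indicator_of_mem ht, ContinuousLinearMap.lsmul_apply, smul_eq_mul]
      ring
    · simp only [f, indicator_of_notMem ht, map_zero]
  rw [hc]
  exact key

lemma norm_le_sum_abs {d : ℕ} (v : Vec d) : ‖v‖ ≤ ∑ i, |v i| := by
  conv_lhs => rw [← (EuclideanSpace.basisFun (Fin d) ℝ).sum_repr v]
  refine (norm_sum_le _ _).trans (Finset.sum_le_sum fun i _ => ?_)
  rw [norm_smul]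
  simp

lemma hasDistribDeriv_distribDeriv {T : ℝ} {d : ℕ} (u : BV T d) :
    HasDistribDeriv (u : Lp (Vec d) 1 (vol T)) (distribDeriv u) := u.2.choose_spec

/-- The embedding of `BV((0, T); ℝ^d)` into `L²((0, T); ℝ^d)` is bounded. -/
lemma exists_norm_toL2_le {T : ℝ} (hT : 0 < T) (d : ℕ) :
    ∃ M : ℝ, ∀ u : BV T d, ‖toL2 u‖ ≤ M * bvNorm u := by
  obtain ⟨M, hM, hMu⟩ := exists_ae_abs_coord_le hT d
  refine ⟨((vol T univ) ^ (2 : ENNReal).toReal⁻¹).toReal * (d * M), fun u => ?_⟩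
  have hb : 0 ≤ bvNorm u := add_nonneg (mnorm_nonneg _) (norm_nonneg _)
  have hae : ∀ᵐ t ∂(vol T), ‖(u : Lp (Vec d) 1 (vol T)) t‖ ≤ d * M * bvNorm u := by
    filter_upwards [ae_all_iff.2 (hMu u _ (hasDistribDeriv_distribDeriv u))] with t ht
    calc _ ≤ _ := norm_le_sum_abs _
      _ ≤ ∑ _ : Fin d, M * bvNorm u := Finset.sum_le_sum fun i _ => ht i
      _ = d * M * bvNorm u := by simp [mul_assoc]
  have hfin : (vol T univ) ^ (2 : ENNReal).toReal⁻¹ ≠ ⊤ :=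
    ENNReal.rpow_ne_top_of_nonneg (by positivity) (measure_ne_top _ _)
  have := eLpNorm_le_of_ae_bound (p := 2) hae
  unfold toL2
  rw [Lp.norm_toLp]
  refine (ENNReal.toReal_mono (ENNReal.mul_ne_top hfin ENNReal.ofReal_ne_top) this).trans ?_
  rw [ENNReal.toReal_mul, ENNReal.toReal_ofReal (by positivity)]
  exact le_of_eq (by ring)

/-! ### Weak limits in `L²` and lower semicontinuity -/

/-- Weak compactness of bounded sets in a Hilbert space. -/
lemma exists_weak_limit {H ι : Type*} [NormedAddCommGroup H] [InnerProductSpace ℝ H]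
    [CompleteSpace H] {U : Ultrafilter ι} {x : ι → H} {R : ℝ}
    (h : ∀ᶠ k in (U : Filter ι), ‖x k‖ ≤ R) :
    ∃ w : H, ∀ ℓ : StrongDual ℝ H, Tendsto (fun k => ℓ (x k)) U (𝓝 (ℓ w)) := by
  have hbd : ∀ y : H, ∀ᶠ k in (U : Filter ι), |inner ℝ (x k) y| ≤ R * ‖y‖ := fun y =>
    h.mono fun k hk => (abs_real_inner_le_norm _ _).trans
      (mul_le_mul_of_nonneg_right hk (norm_nonneg y))
  choose l hl using fun y => exists_tendsto_of_eventually_abs_le (hbd y)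
  -- The limits of the inner products form a bounded functional, whose Riesz representative is the
  -- weak limit.
  let L : StrongDual ℝ H := LinearMap.mkContinuous
    { toFun := l
      map_add' := fun y z => tendsto_nhds_unique (hl (y + z)) (by
        simpa only [inner_add_right] using (hl y).add (hl z))
      map_smul' := fun c y => tendsto_nhds_unique (hl (c • y)) (by
        simpa only [real_inner_smul_right, smul_eq_mul, RingHom.id_apply] using (hl y).const_mul c) } R
    fun y => le_of_tendsto (hl y).abs (hbd y)
  refine ⟨(InnerProductSpace.toDual ℝ H).symm L, fun ℓ => ?_⟩
  obtain ⟨z, rfl⟩ := (InnerProductSpace.toDual ℝ H).surjective ℓ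
  have h1 : ∀ y : H, InnerProductSpace.toDual ℝ H z y = inner ℝ y z := fun y =>
    real_inner_comm _ _
  simp only [h1, InnerProductSpace.toDual_symm_apply]
  exact hl z

/-- A convex differentiable function lies above its tangents. -/
lemma ConvexOn.add_fderiv_le {E : Type*} [NormedAddCommGroup E] [NormedSpace ℝ E] {F : E → ℝ}
    (hF : ConvexOn ℝ univ F) {x : E} (hx : DifferentiableAt ℝ F x) (y : E) :
    F x + fderiv ℝ F x (y - x) ≤ F y := by
  have hc : ConvexOn ℝ univ (F ∘ AffineMap.lineMap (k := ℝ) x y) := by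
    simpa using hF.comp_affineMap (AffineMap.lineMap (k := ℝ) x y)
  have hx' : HasFDerivAt F (fderiv ℝ F x) (AffineMap.lineMap (k := ℝ) x y 0) := by
    simpa using hx.hasFDerivAt
  have hd : HasDerivAt (F ∘ AffineMap.lineMap (k := ℝ) x y) (fderiv ℝ F x (y - x)) 0 :=
    hx'.comp_hasDerivAt 0 AffineMap.hasDerivAt_lineMap
  have := hc.le_slope_of_hasDerivAt (mem_univ 0) (mem_univ 1) zero_lt_one hd
  rw [slope_def_field] at this
  simp only [Function.comp_apply, AffineMap.lineMap_apply_one, AffineMap.lineMap_apply_zero,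
    sub_zero, div_one] at this
  linarith

/-- The zero function is of bounded variation. -/
lemma zero_mem_BV (T : ℝ) (d : ℕ) : (0 : Lp (Vec d) 1 (vol T)) ∈ BV T d := by
  refine ⟨0, fun φ _ => ?_⟩
  rw [pairing, VectorMeasure.integral_zero_vectorMeasure, neg_zero]
  refine integral_eq_zero_of_ae ?_
  filter_upwards [Lp.coeFn_zero (Vec d) 1 (vol T)] with t ht
  rw [ht, Pi.zero_apply, inner_zero_left, Pi.zero_apply]

/-- The derivative of a test function is square integrable. -/
lemma IsTest.memLp_deriv {T : ℝ} {d : ℕ} {φ : ℝ → Vec d} (hφ : IsTest T φ) :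
    MemLp (deriv φ) 2 (vol T) := by
  have hc : Continuous (deriv φ) := hφ.smooth.continuous_deriv (by simp)
  obtain ⟨C, hC⟩ := hφ.compact.deriv.exists_bound_of_continuous hc
  exact MemLp.of_bound hc.aestronglyMeasurable C (Eventually.of_forall hC)

lemma coeFn_toL2 {T : ℝ} {d : ℕ} (u : BV T d) :
    toL2 u =ᵐ[vol T] (u : Lp (Vec d) 1 (vol T)) := MemLp.coeFn_toLp _

/-- Weak lower semicontinuity and compactness: along an ultrafilter on which the `BV` norm is
bounded, there is a weak limit in `L²` whose derivative is controlled by the limit of the norms. -/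
lemma exists_BV_limit {T : ℝ} (hT : 0 < T) {d : ℕ} {U : Ultrafilter (BV T d)} {R : ℝ}
    (hR : ∀ᶠ u in (U : Filter (BV T d)), bvNorm u ≤ R) :
    ∃ (w : BV T d) (m : ℝ), mnorm (distribDeriv w) ≤ m ∧
      Tendsto (fun u : BV T d => mnorm (distribDeriv u)) U (𝓝 m) ∧
      ∀ ℓ : StrongDual ℝ (Lp (Vec d) 2 (vol T)),
        Tendsto (fun u => ℓ (toL2 u)) U (𝓝 (ℓ (toL2 w))) := by
  obtain ⟨M, hM⟩ := exists_norm_toL2_le hT d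
  have hR2 : ∀ᶠ u in (U : Filter (BV T d)), ‖toL2 u‖ ≤ |M| * R := hR.mono fun u hu =>
    (hM u).trans (mul_le_mul (le_abs_self M) hu (add_nonneg (mnorm_nonneg _) (norm_nonneg _))
      (abs_nonneg M))
  have hRm : ∀ᶠ u in (U : Filter (BV T d)), mnorm (distribDeriv u) ≤ R := hR.mono fun u hu =>
    (le_add_of_nonneg_right (norm_nonneg _)).trans hu
  obtain ⟨w, hw⟩ := exists_weak_limit hR2
  obtain ⟨q, hq⟩ := exists_limit_vmeas hRm
  obtain ⟨m, hm⟩ := exists_tendsto_of_eventually_abs_le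
    (hRm.mono fun u hu => (abs_of_nonneg (mnorm_nonneg (distribDeriv u))).trans_le hu)
  -- Integration against `φ'` is a continuous functional on `L²`, so weak convergence carries over
  -- the defining equation of the derivative.
  have hinner : ∀ {φ : ℝ → Vec d} (hφ : IsTest T φ) (v : Lp (Vec d) 2 (vol T)) (f : ℝ → Vec d),
      v =ᵐ[vol T] f → innerSL ℝ hφ.memLp_deriv.toLp v =
        ∫ t in Ioo 0 T, inner ℝ (f t) (deriv φ t) := fun hφ v f hvf => by
    rw [innerSL_apply_apply, L2.inner_def]
    refine integral_congr_ae ?_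
    filter_upwards [hvf, hφ.memLp_deriv.coeFn_toLp] with t h1 h2
    rw [h1, h2, real_inner_comm]
  have hpair : ∀ {φ : ℝ → Vec d} (hφ : IsTest T φ) (u : BV T d),
      innerSL ℝ hφ.memLp_deriv.toLp (toL2 u) = -pairing (fun t => φ t) (distribDeriv u) :=
    fun hφ u => (hinner hφ _ _ (coeFn_toL2 u)).trans (hasDistribDeriv_distribDeriv u _ hφ)
  have hw1 : MemLp w 1 (vol T) := (Lp.memLp w).mono_exponent (by norm_num)
  have hwq : HasDistribDeriv hw1.toLp q := fun φ hφ => by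
    rw [← hinner hφ w _ hw1.coeFn_toLp.symm]
    refine tendsto_nhds_unique (hw _) ?_
    simp only [hpair hφ]
    exact (hq _ hφ.continuous_restrict hφ.hasCompactSupport_restrict).neg
  let v : BV T d := ⟨hw1.toLp, q, hwq⟩
  have hv : toL2 v = w := Lp.ext ((coeFn_toL2 v).trans hw1.coeFn_toLp)
  refine ⟨v, m, mnorm_le_of_forall_isTest
    (ge_of_tendsto' hm fun u => mnorm_nonneg _) fun φ hφ C hC hφC => ?_, hm, hv.symm ▸ hw⟩
  -- `distribDeriv v` is a chosen derivative, not `q` by definition. Its pairings with test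
  -- functions are determined by `v` through `hpair`, so uniqueness is not needed.
  have hlim : Tendsto (fun u : BV T d => |pairing (fun t => φ t) (distribDeriv u)|) U
      (𝓝 |pairing (fun t => φ t) (distribDeriv v)|) := by
    have := (hw (innerSL ℝ hφ.memLp_deriv.toLp)).abs
    rw [← hv] at this
    simpa only [hpair hφ, abs_neg] using this
  exact le_of_tendsto_of_tendsto' hlim (hm.mul_const C) fun u =>
    abs_pairing_le_mnorm (distribDeriv u) hφ.toC0 hC hφC

/-- The sublevel sets of a radially unbounded functional are bounded. -/
lemma RadiallyUnbounded.exists_bvNorm_le {T : ℝ} {d : ℕ} {j : BV T d → ℝ}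
    (hj : RadiallyUnbounded j) (c : ℝ) : ∃ R, ∀ u, j u ≤ c → bvNorm u ≤ R := by
  by_contra! h
  choose u hu hun using fun n : ℕ => h n
  have h1 := hj u (tendsto_atTop_mono (fun n => (hun n).le) tendsto_natCast_atTop_atTop)
  obtain ⟨n, hn⟩ := (h1.eventually (eventually_gt_atTop c)).exists
  exact hn.not_ge (hu n)

end BVMin

/-! ### Existence of a minimizer -/

theorem mainTheorem8 {Y : Type*} [NormedAddCommGroup Y] [InnerProductSpace ℝ Y] [CompleteSpace Y]
    (T : ℝ) (hT : 0 < T) (d : ℕ) (β : ℝ) (hβ : 0 < β)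
    (K : Lp (BVMin.Vec d) 2 (BVMin.vol T) →L[ℝ] Y)
    (F : Y → ℝ) (hF : StrictConvexOn ℝ univ F) (hF1 : ContDiff ℝ 1 F)
    (hj : BVMin.RadiallyUnbounded (BVMin.objective K F β)) :
    ∃ u : BVMin.BV T d, ∀ v : BVMin.BV T d,
      BVMin.objective K F β u ≤ BVMin.objective K F β v := by
  let j := BVMin.objective K F β
  have : Nonempty (BVMin.BV T d) := ⟨⟨0, BVMin.zero_mem_BV T d⟩⟩
  -- Sublevel sets are nested and each contains its own `v`, so they generate a proper filter. No
  -- lower bound on `j` is required beforehand.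
  have hne : (⨅ v, 𝓟 {u | j u ≤ j v}).NeBot := by
    refine iInf_neBot_of_directed' (fun v v' => ?_) fun v => principal_neBot_iff.2 ⟨v, le_refl (j v)⟩
    rcases le_total (j v) (j v') with h | h
    · exact ⟨v, le_rfl, principal_mono.2 fun u hu => le_trans hu h⟩
    · exact ⟨v', principal_mono.2 fun u hu => le_trans hu h, le_rfl⟩
  let U := Ultrafilter.of (⨅ v, 𝓟 {u | j u ≤ j v})
  have hU : ∀ v, ∀ᶠ u in (U : Filter (BVMin.BV T d)), j u ≤ j v := fun v =>
    Ultrafilter.of_le _ (mem_iInf_of_mem v (mem_principal_self _))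
  obtain ⟨v₀⟩ := this
  obtain ⟨R, hR⟩ := hj.exists_bvNorm_le (j v₀)
  obtain ⟨w, m, hwm, hm, hw⟩ := BVMin.exists_BV_limit hT ((hU v₀).mono hR)
  refine ⟨w, fun v => ?_⟩
  let ℓ := (fderiv ℝ F (K (BVMin.toL2 w))).comp K
  -- `F` is replaced by its tangent at `K w`: a lower bound for the objective that converges along
  -- `U`.
  have hlim : Tendsto (fun u => F (K (BVMin.toL2 w)) + (ℓ (BVMin.toL2 u) - ℓ (BVMin.toL2 w)) +
      β * BVMin.mnorm (BVMin.distribDeriv u)) U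
      (𝓝 (F (K (BVMin.toL2 w)) + (ℓ (BVMin.toL2 w) - ℓ (BVMin.toL2 w)) + β * m)) :=
    (((hw ℓ).sub_const _).const_add _).add (hm.const_mul β)
  rw [sub_self, add_zero] at hlim
  refine (add_le_add_right (mul_le_mul_of_nonneg_left hwm hβ.le) _).trans
    (le_of_tendsto hlim ((hU v).mono fun u hu => le_trans ?_ hu))
  refine add_le_add_left ?_ _
  have := BVMin.ConvexOn.add_fderiv_le hF.convexOn
    (hF1.differentiable (by simp) (K (BVMin.toL2 w))) (K (BVMin.toL2 u))
  rwa [map_sub] at this
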